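/- **Setting.** Let $\mathbb{C}^{n\times p}$ carry the real inner product $\Re\langle A,B\rangle=\Re\,\mathrm{tr}(A^*B)$ and the Frobenius norm, let $\mathrm{St}(n,p)=\{X\in\mathbb{C}^{n\times p}:X^*X=I_p\}$ be the complex Stiefel manifold with the induced metric, $T_X=\{\xi: X^*\xi+\xi^*X=0\}$, $\mathrm{sym}(A)=(A+A^*)/2$ and $\mathrm{Proj}_X(U)=U-X\,\mathrm{sym}(X^*U)$. Let $f:\mathbb{C}^{n\times p}\to\mathbb{R}$ be $\mathbb{R}$-differentiable with Euclidean gradient $\nabla f$, Euclidean Hessian $\nabla^2 f$ (the derivative of $\nabla f$), Riemannian gradient $\mathrm{grad}\,f(X)=\mathrm{Proj}_X(\nabla f(X))$ and Riemannian Hessian $\mathrm{Hess}\,f(X)[\xi]=\mathrm{Proj}_X\big(\nabla^2f(X)[\xi]-\xi\,\mathrm{sym}(X^*\nabla f(X))\big)$, $\xi\in T_X$. **Algorithm.** Fix $0<\eta_1\le\eta_2<1$, $0<\gamma_0<1<\gamma_1\le\gamma_2$, and either $d(X,Y)=\|X-Y\|_F^2$ (quadratic regularization) or $d(X,Y)=\tfrac23\|X-Y\|_F^3$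 (cubic regularization). A run of the regularized quasi-Newton method (without subspace refinement) consists of iterates $X^k$ with $X^0\in\mathrm{St}(n,p)$, trial points $Z^k\in\mathrm{St}(n,p)$, self-adjoint real-linear operators $B^k$ on $\mathbb{C}^{n\times p}$ and numbers $\tau_k$ with $\tau_0>0$ such that, with $$m_k(X)=\Re\langle\nabla f(X^k),X-X^k\rangle+\tfrac12\Re\langle B^k[X-X^k],X-X^k\rangle+\tfrac{\tau_k}{2}d(X,X^k),\qquad r_k=\frac{f(Z^k)-f(X^k)}{m_k(Z^k)},$$ one has $X^{k+1}=Z^k$ if $r_k\ge\eta_1$ and $X^{k+1}=X^k$ otherwise, and $\tau_{k+1}\in(0,\gamma_0\tau_k]$ if $r_k\ge\eta_2$, $\tau_{k+1}\in[\tau_k,\gamma_1\tau_k]$ if $\eta_1\le r_k<\eta_2$, and $\tau_{k+1}\in[\gamma_1\tau_k,\gamma_2\tau_k]$ if $r_k<\eta_1$. The method stops at stationary points, so that $\mathrm{grad}\,f(X^k)\ne0$ for all $k$ in an infinite run. **Theorem.** Let $X_*\in\mathrm{St}(n,p)$ with $\mathrm{grad}\,f(X_*)=0$. Assume that $\nabla^2f$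 exists and is continuous on $\mathrm{conv}(\mathrm{St}(n,p))$ and that $\mathrm{Hess}\,f(X_*)$ is positive definite on $T_{X_*}$. Then there is $\delta>0$, depending only on $f$ and $X_*$ (and $n$, $p$), such that the following holds for every choice of the parameters and of the regularization and for every infinite run: if * $X^k\to X_*$, and $\|Z^k-X^k\|_F<\delta$ for all sufficiently large $k$ (in particular if $Z^k-X^k\to0$); * $\|(B^k-\nabla^2f(X^k))[Z^k-X^k]\|_F\,/\,\|Z^k-X^k\|_F\to0$; * for some constant $c>0$ and all $k$, $m_k(Z^k)\le-c\,\|\mathrm{grad}\,f(X^k)\|_F^2$ and $\|\mathrm{grad}\,m_k(Z^k)\|_F\le\theta^k\|\mathrm{grad}\,f(X^k)\|_F$, where $\theta^k=\min\{1,\|\mathrm{grad}\,f(X^k)\|_F\}$, then all iterations are eventually very successful, i.e. $r_k\ge\eta_2$ for all sufficiently large $k$, and $X^k$ converges q-superlinearly to $X_*$, i.e. $\mathrm{dist}(X^k,X_*)\to0$ and $$\frac{\mathrm{dist}(X^{k+1},X_*)}{\mathrm{dist}(X^k,X_*)}\to0,$$ where $\mathrm{dist}$ is the geodesic distance on $\mathrm{St}(n,p)$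 (and $\mathrm{dist}(X^k,X_*)>0$ for all large $k$). -/

import Mathlib

open Filter Topology Set
open scoped Matrix

/- Matrices carry the Frobenius norm `‖A‖ = sqrt (tr (Aᴴ A))`. The (equal) entrywise topology and
uniformity are removed from instance search, so that only those of the norm are found. -/
attribute [-instance] instTopologicalSpaceMatrix Matrix.instUniformSpace
attribute [local instance] Matrix.frobeniusNormedAddCommGroup Matrix.frobeniusNormedSpace

namespace StiefelQN

/-- The ambient space `ℂ^{n × p}`, viewed as a real Euclidean space. -/
abbrev Mat (n p : ℕ) : Type := Matrix (Fin n) (Fin p) ℂ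

theorem re_trace_conjTranspose_mul_self {n p : ℕ} (A : Mat n p) :
    (Matrix.trace (Aᴴ * A)).re = ‖A‖ ^ 2 := by
  rw [Matrix.frobenius_norm_def, ← Real.sqrt_eq_rpow, Real.sq_sqrt (by positivity),
    Finset.sum_comm]
  simp only [Matrix.trace, Matrix.diag_apply, Matrix.mul_apply, Matrix.conjTranspose_apply,
    Complex.re_sum]
  refine Finset.sum_congr rfl fun i _ => Finset.sum_congr rfl fun j _ => ?_
  simp [Complex.sq_norm, Complex.normSq_apply]

/-- The real inner product `Re ⟨A, B⟩ = Re tr (Aᴴ B)`; its norm is the Frobenius norm. -/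
noncomputable instance instInnerProductSpaceMat {n p : ℕ} : InnerProductSpace ℝ (Mat n p) :=
  { (Matrix.frobeniusNormedSpace : NormedSpace ℝ (Mat n p)) with
    inner := fun A B => (Matrix.trace (Aᴴ * B)).re
    norm_sq_eq_re_inner := fun A => by
      simpa using (re_trace_conjTranspose_mul_self A).symm
    conj_inner_symm := fun A B => by
      have h : Matrix.trace (Bᴴ * A) = star (Matrix.trace (Aᴴ * B)) := by
        rw [← Matrix.trace_conjTranspose, Matrix.conjTranspose_mul,
          Matrix.conjTranspose_conjTranspose]
      simp [h]
    add_left := fun A B C => by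
      simp [Matrix.conjTranspose_add, Matrix.add_mul]
    smul_left := fun A B r => by
      simp [Matrix.conjTranspose_smul] }

theorem inner_eq {n p : ℕ} (A B : Mat n p) : inner ℝ A B = (Matrix.trace (Aᴴ * B)).re := rfl

/-- The complex Stiefel manifold `St(n,p) = {X : Xᴴ X = I_p}`. -/
def St (n p : ℕ) : Set (Mat n p) := {X | Xᴴ * X = 1}

/-- `sym(A) = (A + Aᴴ)/2`. -/
noncomputable def sym {p : ℕ} (A : Mat p p) : Mat p p := (1 / 2 : ℝ) • (A + Aᴴ)

/-- The tangent space `T_X = {ξ : Xᴴ ξ + ξᴴ X = 0}`. -/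
def tangent {n p : ℕ} (X : Mat n p) : Set (Mat n p) := {ξ | Xᴴ * ξ + ξᴴ * X = 0}

/-- `Proj_X(U) = U - X sym(Xᴴ U)`, the orthogonal projection onto `T_X`. -/
noncomputable def proj {n p : ℕ} (X U : Mat n p) : Mat n p := U - X * sym (Xᴴ * U)

/-- The Riemannian gradient `grad f(X) = Proj_X(∇f(X))`, where `∇f(X)` is the Euclidean gradient
for the inner product `Re tr (Aᴴ B)`. -/
noncomputable def rgrad {n p : ℕ} (f : Mat n p → ℝ) (X : Mat n p) : Mat n p :=
  proj X (gradient f X)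

/-- The Euclidean Hessian `∇²f(X)`: the (real) derivative of the gradient map. -/
noncomputable def hess {n p : ℕ} (f : Mat n p → ℝ) (X : Mat n p) : Mat n p →L[ℝ] Mat n p :=
  fderiv ℝ (gradient f) X

/-- The Riemannian Hessian `Hess f(X)[ξ] = Proj_X(∇²f(X)[ξ] - ξ sym(Xᴴ ∇f(X)))`, `ξ ∈ T_X`. -/
noncomputable def rhess {n p : ℕ} (f : Mat n p → ℝ) (X ξ : Mat n p) : Mat n p :=
  proj X (hess f X ξ - ξ * sym (Xᴴ * gradient f X))

/-- Positive definiteness of the Riemannian Hessian at `X`. -/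
def RHessPosDef {n p : ℕ} (f : Mat n p → ℝ) (X : Mat n p) : Prop :=
  ∀ ξ ∈ tangent X, ξ ≠ 0 → 0 < inner ℝ (rhess f X ξ) ξ

/-- `∇²f` exists at every point of `conv(St(n,p))` and is continuous there. -/
def HessContinuous {n p : ℕ} (f : Mat n p → ℝ) : Prop :=
  (∀ X ∈ convexHull ℝ (St n p), DifferentiableAt ℝ (gradient f) X) ∧
    ContinuousOn (hess f) (convexHull ℝ (St n p))

/-- The two choices of the regularization term. -/
inductive Regularization
  | quadratic
  | cubic

/-- The proximal term `d(X,Y)`: `‖X - Y‖²` or `(2/3) ‖X - Y‖³`. -/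
noncomputable def Regularization.dist {n p : ℕ} (reg : Regularization) (X Y : Mat n p) : ℝ :=
  match reg with
  | .quadratic => ‖X - Y‖ ^ 2
  | .cubic => 2 / 3 * ‖X - Y‖ ^ 3

/-- The model `m(X) = Re⟨∇f(Y), X - Y⟩ + (1/2) Re⟨B[X - Y], X - Y⟩ + (τ/2) d(X, Y)` of `f`
around the current iterate `Y`. -/
noncomputable def model {n p : ℕ} (f : Mat n p → ℝ) (reg : Regularization)
    (B : Mat n p →L[ℝ] Mat n p) (τ : ℝ) (Y X : Mat n p) : ℝ :=
  inner ℝ (gradient f Y) (X - Y) + 1 / 2 * inner ℝ (B (X - Y)) (X - Y)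
    + τ / 2 * reg.dist X Y

/-- The ratio `r = (f(Z) - f(Y)) / m(Z)` of actual to predicted reduction for the trial point `Z`
at the iterate `Y`. -/
noncomputable def ratio {n p : ℕ} (f : Mat n p → ℝ) (reg : Regularization)
    (B : Mat n p →L[ℝ] Mat n p) (τ : ℝ) (Y Z : Mat n p) : ℝ :=
  (f Z - f Y) / model f reg B τ Y Z

/-- Parameters of the trust-region-like update. -/
structure Params where
  η₁ : ℝ
  η₂ : ℝ
  γ₀ : ℝ
  γ₁ : ℝ
  γ₂ : ℝ
  η₁_pos : 0 < η₁
  η₁_le_η₂ : η₁ ≤ η₂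
  η₂_lt_one : η₂ < 1
  γ₀_pos : 0 < γ₀
  γ₀_lt_one : γ₀ < 1
  one_lt_γ₁ : 1 < γ₁
  γ₁_le_γ₂ : γ₁ ≤ γ₂

/-- `X` (iterates), `Z` (trial points), `B` (self-adjoint Hessian approximations) and `τ`
(regularization parameters) form an infinite run of the regularized quasi-Newton method without
subspace refinement. -/
structure IsRun {n p : ℕ} (f : Mat n p → ℝ) (reg : Regularization) (P : Params)
    (X Z : ℕ → Mat n p) (B : ℕ → Mat n p →L[ℝ] Mat n p) (τ : ℕ → ℝ) : Prop where
  init_mem : X 0 ∈ St n p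
  trial_mem : ∀ k, Z k ∈ St n p
  τ_pos : 0 < τ 0
  symm : ∀ k U V, inner ℝ (B k U) V = inner ℝ U (B k V)
  /-- The method stops at a stationary point, so an infinite run never meets one. -/
  not_stopped : ∀ k, rgrad f (X k) ≠ 0
  accept : ∀ k, P.η₁ ≤ ratio f reg (B k) (τ k) (X k) (Z k) → X (k + 1) = Z k
  reject : ∀ k, ratio f reg (B k) (τ k) (X k) (Z k) < P.η₁ → X (k + 1) = X k
  τ_very_successful : ∀ k, P.η₂ ≤ ratio f reg (B k) (τ k) (X k) (Z k) →
    τ (k + 1) ∈ Ioc 0 (P.γ₀ * τ k)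
  τ_successful : ∀ k, P.η₁ ≤ ratio f reg (B k) (τ k) (X k) (Z k) →
    ratio f reg (B k) (τ k) (X k) (Z k) < P.η₂ → τ (k + 1) ∈ Icc (τ k) (P.γ₁ * τ k)
  τ_unsuccessful : ∀ k, ratio f reg (B k) (τ k) (X k) (Z k) < P.η₁ →
    τ (k + 1) ∈ Icc (P.γ₁ * τ k) (P.γ₂ * τ k)

/-- First inexactness condition: `m_k(Z^k) ≤ -c ‖grad f(X^k)‖²`. -/
def Inexact₁ {n p : ℕ} (f : Mat n p → ℝ) (reg : Regularization)
    (X Z : ℕ → Mat n p) (B : ℕ → Mat n p →L[ℝ] Mat n p) (τ : ℕ → ℝ) (c : ℝ) : Prop :=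
  ∀ k, model f reg (B k) (τ k) (X k) (Z k) ≤ -c * ‖rgrad f (X k)‖ ^ 2

/-- Second inexactness condition: `‖grad m_k(Z^k)‖ ≤ θ^k ‖grad f(X^k)‖` with
`θ^k = min {1, ‖grad f(X^k)‖}`. -/
def Inexact₂ {n p : ℕ} (f : Mat n p → ℝ) (reg : Regularization)
    (X Z : ℕ → Mat n p) (B : ℕ → Mat n p →L[ℝ] Mat n p) (τ : ℕ → ℝ) : Prop :=
  ∀ k, ‖rgrad (model f reg (B k) (τ k) (X k)) (Z k)‖ ≤
    min 1 ‖rgrad f (X k)‖ * ‖rgrad f (X k)‖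

/-- The Dennis–Moré condition `‖(B^k - ∇²f(X^k))[Z^k - X^k]‖ / ‖Z^k - X^k‖ → 0`. -/
def DennisMore {n p : ℕ} (f : Mat n p → ℝ)
    (X Z : ℕ → Mat n p) (B : ℕ → Mat n p →L[ℝ] Mat n p) : Prop :=
  Tendsto (fun k => ‖(B k - hess f (X k)) (Z k - X k)‖ / ‖Z k - X k‖) atTop (𝓝 0)

/-- Geodesic distance on `St(n,p)` for the metric `Re tr (ξᴴ η)`: the infimum of the lengths of
the `C¹` curves in `St(n,p)` that join `X` to `Y`. -/
noncomputable def geodDist {n p : ℕ} (X Y : Mat n p) : ℝ :=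
  sInf {L : ℝ | ∃ γ : ℝ → Mat n p, ContDiffOn ℝ 1 γ (Icc 0 1) ∧ (∀ t ∈ Icc (0 : ℝ) 1, γ t ∈ St n p) ∧
    γ 0 = X ∧ γ 1 = Y ∧ L = ∫ t in (0 : ℝ)..1, ‖derivWithin γ (Icc 0 1) t‖}

/-- `X^k → X_*` q-superlinearly in geodesic distance. The distances are eventually positive, so the
quotients are meaningful. -/
def QSuperlinear {n p : ℕ} (X : ℕ → Mat n p) (Xs : Mat n p) : Prop :=
  Tendsto (fun k => geodDist (X k) Xs) atTop (𝓝 0) ∧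
    (∀ᶠ k in atTop, 0 < geodDist (X k) Xs) ∧
    Tendsto (fun k => geodDist (X (k + 1)) Xs / geodDist (X k) Xs) atTop (𝓝 0)

end StiefelQN

/-!
Let `S = sym(Xsᴴ ∇f(Xs))` be the Lagrange multiplier at the limit point `Xs`. The Lagrangian
`f - (1/2) Re ⟨S, XᴴX⟩` differs from `f` by a constant on the Stiefel manifold, has the same
Riemannian gradient there (`rgrad_eq_proj_lagrGrad`), has vanishing Euclidean gradient at `Xs`, and
its Hessian `A` at `Xs` represents the Riemannian Hessian on the tangent space. Chords `Z - X` of the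
manifold near `Xs` are tangent at `Xs` up to a small relative error, so `A` is uniformly positive on
them (`exists_chord_coercive`). This needs `X` and `Z` in a fixed ball around `Xs`, which is where
`δ` comes from. It also yields the error bound `‖X - Xs‖ ≤ C ‖grad f(X)‖` (`exists_error_bound`).

The model rewrites as `⟨∇L(X), s⟩ + (1/2) ⟨A s, s⟩ + o(‖s‖²) + (τ/2) d` with `s = Z - X`, by the
Dennis–Moré condition (`model_chord`). Since it is negative at the trial point, coercivity forces
`‖s‖ ≤ C ‖∇L(X)‖` (`norm_step_le`), hence `s → 0` and `‖s‖ ≤ C' ‖grad f(X)‖`. Therefore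
`f(Z) - f(X) ≤ m(Z) + o(‖grad f(X)‖²)`, and the sufficient decrease `m(Z) ≤ -c ‖grad f(X)‖²` makes
the ratio at least `η₂`. From then on `τ` decays geometrically and every trial point is accepted,
and `‖grad f(Z)‖ ≤ ‖grad m(Z)‖ + o(‖s‖) = o(‖grad f(X)‖)` (`norm_rgrad_trial_le`).

The error bound turns this into superlinear convergence in Frobenius distance. The geodesic distance
is locally equivalent to it (`norm_sub_le_geodDist_le`): a chord `Y(t) = X + t D` normalized to
`Y (Yᴴ Y)^(-1/2)` is a curve in the manifold of length `O(‖D‖)`.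
-/

namespace StiefelQN

variable {n p : ℕ}

/-! ### The inner product, symmetrization and projection -/

theorem inner_mul_left (X : Mat n p) (U : Mat p p) (V : Mat n p) :
    inner ℝ (X * U) V = inner ℝ U (Xᴴ * V) := by
  simp only [inner_eq, Matrix.conjTranspose_mul, Matrix.mul_assoc]

theorem inner_conjTranspose_left (A B : Mat p p) : inner ℝ Aᴴ B = inner ℝ A Bᴴ := by
  rw [inner_eq, inner_eq, Matrix.conjTranspose_conjTranspose, ← Matrix.conjTranspose_mul,
    Matrix.trace_conjTranspose, Matrix.trace_mul_comm]
  simp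

theorem inner_sym_left (A B : Mat p p) : inner ℝ (sym A) B = inner ℝ A (sym B) := by
  simp only [sym, inner_smul_left, inner_smul_right, inner_add_left, inner_add_right,
    inner_conjTranspose_left]
  simp

theorem conjTranspose_sym (A : Mat p p) : (sym A)ᴴ = sym A := by
  simp [sym, Matrix.conjTranspose_smul, add_comm]

theorem sym_of_conjTranspose_eq {S : Mat p p} (hS : Sᴴ = S) : sym S = S := by
  rw [sym, hS, ← two_smul ℝ S, smul_smul]
  norm_num

theorem sym_sub (A B : Mat p p) : sym (A - B) = sym A - sym B := by
  simp only [sym, Matrix.conjTranspose_sub, smul_sub, smul_add]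
  abel

theorem norm_sym_le (A : Mat p p) : ‖sym A‖ ≤ ‖A‖ := by
  rw [sym, norm_smul]
  have := norm_add_le A Aᴴ
  rw [Matrix.frobenius_norm_conjTranspose] at this
  norm_num
  linarith

theorem proj_sub (X U V : Mat n p) : proj X (U - V) = proj X U - proj X V := by
  simp only [proj, Matrix.mul_sub, sym_sub]
  abel

/-- `proj X` is self-adjoint. -/
theorem inner_proj_left (X U V : Mat n p) : inner ℝ (proj X U) V = inner ℝ U (proj X V) := by
  have : inner ℝ (X * sym (Xᴴ * U)) V = inner ℝ U (X * sym (Xᴴ * V)) := by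
    rw [inner_mul_left, inner_sym_left, real_inner_comm, real_inner_comm _ U, inner_mul_left]
  simp only [proj, inner_sub_left, inner_sub_right, this]

/-- The matrices `X * S` with `S` Hermitian are normal to the Stiefel manifold at `X`. -/
theorem proj_mul_of_conjTranspose_eq {X : Mat n p} (hX : X ∈ St n p) {S : Mat p p} (hS : Sᴴ = S) :
    proj X (X * S) = 0 := by
  rw [proj, ← Matrix.mul_assoc, show Xᴴ * X = 1 from hX, Matrix.one_mul,
    sym_of_conjTranspose_eq hS, sub_self]

theorem proj_mem_tangent {X : Mat n p} (hX : X ∈ St n p) (U : Mat n p) : proj X U ∈ tangent X := by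
  have h1 : Xᴴ * proj X U = Xᴴ * U - sym (Xᴴ * U) := by
    rw [proj, Matrix.mul_sub, ← Matrix.mul_assoc, show Xᴴ * X = 1 from hX, Matrix.one_mul]
  have h2 : (proj X U)ᴴ * X = (Xᴴ * U)ᴴ - sym (Xᴴ * U) := by
    rw [← conjTranspose_sym (Xᴴ * U), ← Matrix.conjTranspose_sub, ← h1]
    simp
  have h3 : sym (Xᴴ * U) + sym (Xᴴ * U) = Xᴴ * U + (Xᴴ * U)ᴴ := by
    rw [← two_smul ℝ, sym, smul_smul]
    norm_num
  change _ + _ = _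
  rw [h1, h2, sub_add_sub_comm, h3, sub_self]

theorem proj_of_mem_tangent {X ξ : Mat n p} (hξ : ξ ∈ tangent X) : proj X ξ = ξ := by
  have h : sym (Xᴴ * ξ) = 0 := by
    have : Xᴴ * ξ + ξᴴ * X = 0 := hξ
    simp [sym, this]
  simp [proj, h]

theorem norm_of_mem_St {X : Mat n p} (hX : X ∈ St n p) : ‖X‖ ^ 2 = p := by
  rw [← re_trace_conjTranspose_mul_self, show Xᴴ * X = 1 from hX]
  simp

theorem norm_mul_le' {m : ℕ} (A : Mat n m) (B : Mat m p) : ‖A * B‖ ≤ ‖A‖ * ‖B‖ :=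
  Matrix.frobenius_norm_mul A B

theorem norm_proj_le {X : Mat n p} (hX : X ∈ St n p) (U : Mat n p) :
    ‖proj X U‖ ≤ (1 + p) * ‖U‖ := by
  have h1 : ‖X * sym (Xᴴ * U)‖ ≤ ‖X‖ * (‖X‖ * ‖U‖) := by
    refine (norm_mul_le' _ _).trans ?_
    gcongr
    refine (norm_sym_le _).trans ((norm_mul_le' _ _).trans_eq ?_)
    rw [Matrix.frobenius_norm_conjTranspose]
  calc ‖proj X U‖ ≤ ‖U‖ + ‖X * sym (Xᴴ * U)‖ := norm_sub_le _ _
    _ ≤ ‖U‖ + ‖X‖ * (‖X‖ * ‖U‖) := by gcongr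
    _ = (1 + p) * ‖U‖ := by rw [← norm_of_mem_St hX]; ring

/-! ### Chords of the Stiefel manifold -/

theorem conjTranspose_mul_chord {X Z : Mat n p} (hX : X ∈ St n p) (hZ : Z ∈ St n p) :
    Xᴴ * (Z - X) + (Z - X)ᴴ * X = -((Z - X)ᴴ * (Z - X)) := by
  have h1 : Xᴴ * X = 1 := hX
  have h2 : Zᴴ * Z = 1 := hZ
  simp only [Matrix.conjTranspose_sub, Matrix.mul_sub, Matrix.sub_mul, h1, h2]
  abel

/-- Chords of the Stiefel manifold are tangent up to a quadratic error. -/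
theorem sym_conjTranspose_mul_chord {X Z : Mat n p} (hX : X ∈ St n p) (hZ : Z ∈ St n p) :
    sym (Xᴴ * (Z - X)) = -((1 / 2 : ℝ) • ((Z - X)ᴴ * (Z - X))) := by
  rw [sym, Matrix.conjTranspose_mul, Matrix.conjTranspose_conjTranspose,
    conjTranspose_mul_chord hX hZ, smul_neg]

theorem norm_sym_conjTranspose_mul_chord_le {X Z : Mat n p} (hX : X ∈ St n p) (hZ : Z ∈ St n p) :
    ‖sym (Xᴴ * (Z - X))‖ ≤ ‖Z - X‖ ^ 2 := by
  rw [sym_conjTranspose_mul_chord hX hZ, norm_neg, norm_smul]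
  have := norm_mul_le' (Z - X)ᴴ (Z - X)
  rw [Matrix.frobenius_norm_conjTranspose] at this
  rw [Real.norm_of_nonneg (by norm_num)]
  nlinarith [norm_nonneg ((Z - X)ᴴ * (Z - X))]

/-- Along a chord of the Stiefel manifold the normal term `X * S` acts like the quadratic form of
`- (1/2) S`; this is how the Lagrange multiplier enters the second-order expansion. -/
theorem inner_mul_chord {X Z : Mat n p} (hX : X ∈ St n p) (hZ : Z ∈ St n p) {S : Mat p p}
    (hS : Sᴴ = S) :
    inner ℝ (X * S) (Z - X) = -(1 / 2) * inner ℝ ((Z - X) * S) (Z - X) := by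
  rw [inner_mul_left, ← sym_of_conjTranspose_eq hS, inner_sym_left,
    sym_conjTranspose_mul_chord hX hZ, inner_mul_left, sym_of_conjTranspose_eq hS,
    inner_neg_right, inner_smul_right]
  ring

theorem norm_chord_sub_proj_le {X Z Xs : Mat n p} (hX : X ∈ St n p) (hZ : Z ∈ St n p) :
    ‖(Z - X) - proj Xs (Z - X)‖ ≤ ‖Xs‖ * (‖Z - X‖ + ‖X - Xs‖) * ‖Z - X‖ := by
  have h1 : Xsᴴ * (Z - X) = Xᴴ * (Z - X) - (X - Xs)ᴴ * (Z - X) := by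
    rw [← Matrix.sub_mul, ← Matrix.conjTranspose_sub, sub_sub_cancel]
  have h2 : ‖sym (Xsᴴ * (Z - X))‖ ≤ ‖Z - X‖ ^ 2 + ‖X - Xs‖ * ‖Z - X‖ := by
    rw [h1, sym_sub]
    refine (norm_sub_le _ _).trans (add_le_add (norm_sym_conjTranspose_mul_chord_le hX hZ) ?_)
    refine (norm_sym_le _).trans ((norm_mul_le' _ _).trans_eq ?_)
    rw [Matrix.frobenius_norm_conjTranspose]
  rw [proj, sub_sub_cancel]
  refine (norm_mul_le' _ _).trans ?_
  calc ‖Xs‖ * ‖sym (Xsᴴ * (Z - X))‖ ≤ ‖Xs‖ * (‖Z - X‖ ^ 2 + ‖X - Xs‖ * ‖Z - X‖) := by gcongr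
    _ = _ := by ring

/-! ### Taylor expansion and quadratic forms in an inner product space -/

section InnerProductSpace

variable {F : Type*} [NormedAddCommGroup F] [InnerProductSpace ℝ F]

/-- Second-order Taylor estimate along a segment on which the gradient is close to its
linearization with the fixed operator `H`. -/
theorem abs_taylor_sub_le [CompleteSpace F] {f : F → ℝ} (hf : Differentiable ℝ f) {K : Set F}
    (hK : Convex ℝ K) {H : F →L[ℝ] F} {ε : ℝ} (hε : 0 ≤ ε)
    (h : ∀ x ∈ K, ∀ y ∈ K, ‖gradient f y - gradient f x - H (y - x)‖ ≤ ε * ‖y - x‖)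
    {x y : F} (hx : x ∈ K) (hy : y ∈ K) :
    |f y - f x - inner ℝ (gradient f x) (y - x) - 1 / 2 * inner ℝ (H (y - x)) (y - x)|
      ≤ ε * ‖y - x‖ ^ 2 := by
  set s := y - x with hs
  set ψ : ℝ → ℝ := fun t => f (x + t • s) - t * inner ℝ (gradient f x) s
    - t ^ 2 / 2 * inner ℝ (H s) s with hψ
  have hder : ∀ t : ℝ, HasDerivAt ψ
      (inner ℝ (gradient f (x + t • s) - gradient f x - H (t • s)) s) t := by
    intro t
    have h1 : HasDerivAt (fun t : ℝ => x + t • s) s t := by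
      simpa using ((hasDerivAt_id t).smul_const s).const_add x
    have h2 : HasDerivAt (fun t : ℝ => f (x + t • s)) (inner ℝ (gradient f (x + t • s)) s) t := by
      exact (hf (x + t • s)).hasGradientAt.hasFDerivAt.comp_hasDerivAt t h1
    have h3 := (h2.sub ((hasDerivAt_id t).mul_const (inner ℝ (gradient f x) s))).sub
      ((((hasDerivAt_id t).pow 2).div_const 2).mul_const (inner ℝ (H s) s))
    refine h3.congr_deriv ?_
    simp only [inner_sub_left, map_smul, inner_smul_left]
    simp
  have hb : ∀ t ∈ Ico (0 : ℝ) 1,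
      ‖inner ℝ (gradient f (x + t • s) - gradient f x - H (t • s)) s‖ ≤ ε * ‖s‖ ^ 2 := by
    intro t ht
    have hm : x + t • s ∈ K := hK.add_smul_sub_mem hx hy ⟨ht.1, ht.2.le⟩
    have h1 := h x hx _ hm
    rw [add_sub_cancel_left] at h1
    have h2 : ‖t • s‖ ≤ ‖s‖ := by
      rw [norm_smul, Real.norm_of_nonneg ht.1]
      exact mul_le_of_le_one_left (norm_nonneg _) ht.2.le
    calc _ ≤ _ := norm_inner_le_norm _ _
      _ ≤ (ε * ‖s‖) * ‖s‖ := by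
        gcongr
        exact h1.trans (by gcongr)
      _ = _ := by ring
  have := norm_image_sub_le_of_norm_deriv_le_segment_01'
    (fun t _ => (hder t).hasDerivWithinAt) hb
  rw [Real.norm_eq_abs] at this
  convert this using 2
  simp only [hψ, hs]
  simp
  ring

/-- A quadratic form that is positive on a finite-dimensional subspace is uniformly positive on a
conic neighbourhood of it. -/
theorem exists_coercive_near_submodule [FiniteDimensional ℝ F] (T : Submodule ℝ F) (A : F →L[ℝ] F)
    (hA : ∀ ξ ∈ T, ξ ≠ 0 → 0 < inner ℝ (A ξ) ξ) :
    ∃ κ > 0, ∃ μ > 0, ∀ s : F, (∃ ξ ∈ T, ‖s - ξ‖ ≤ κ * ‖s‖) → μ * ‖s‖ ^ 2 ≤ inner ℝ (A s) s := by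
  obtain ⟨μ, hμ, hT⟩ : ∃ μ > 0, ∀ ξ ∈ T, μ * ‖ξ‖ ^ 2 ≤ inner ℝ (A ξ) ξ := by
    have hc : IsCompact ((T : Set F) ∩ Metric.sphere 0 1) :=
      (isCompact_sphere 0 1).inter_left T.closed_of_finiteDimensional
    rcases ((T : Set F) ∩ Metric.sphere 0 1).eq_empty_or_nonempty with he | hne
    · refine ⟨1, one_pos, fun ξ hξ => ?_⟩
      by_cases h0 : ξ = 0
      · simp [h0]
      · exfalso
        have : (‖ξ‖⁻¹ • ξ) ∈ (T : Set F) ∩ Metric.sphere 0 1 :=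
          ⟨T.smul_mem _ hξ, by simp [norm_smul, h0]⟩
        simp [he] at this
    · obtain ⟨ζ, ⟨hζT, hζ1⟩, hmin⟩ := hc.exists_isMinOn hne
        (f := fun ξ => (inner ℝ (A ξ) ξ : ℝ)) (by fun_prop)
      have hζ0 : ζ ≠ 0 := by
        rintro rfl
        simp at hζ1
      refine ⟨_, hA ζ hζT hζ0, fun ξ hξ => ?_⟩
      by_cases h0 : ξ = 0
      · simp [h0]
      · have hm : (‖ξ‖⁻¹ • ξ) ∈ (T : Set F) ∩ Metric.sphere 0 1 :=
          ⟨T.smul_mem _ hξ, by simp [norm_smul, h0]⟩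
        have h1 : inner ℝ (A ζ) ζ ≤ inner ℝ (A (‖ξ‖⁻¹ • ξ)) (‖ξ‖⁻¹ • ξ) := hmin hm
        simp only [map_smul, inner_smul_left, inner_smul_right] at h1
        have h2 : 0 < ‖ξ‖ := norm_pos_iff.2 h0
        calc _ ≤ _ := mul_le_mul_of_nonneg_right h1 (sq_nonneg ‖ξ‖)
          _ = _ := by
            simp
            field_simp
  set a := ‖A‖ with ha
  have ha0 : 0 ≤ a := norm_nonneg A
  set κ := min (1 / 2) (μ / (24 * (a + 1))) with hκdef
  have hκ : 0 < κ := lt_min (by norm_num) (by positivity)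
  have hκ1 : κ ≤ 1 / 2 := min_le_left _ _
  have hκ2 : a * κ ≤ μ / 24 := by
    have h1 : κ ≤ μ / (24 * (a + 1)) := min_le_right _ _
    rw [le_div_iff₀ (by positivity)] at h1
    nlinarith
  refine ⟨κ, hκ, μ / 8, by positivity, ?_⟩
  rintro s ⟨ξ, hξ, hsξ⟩
  have hS := norm_nonneg s
  have h1 : ‖ξ‖ ≤ 2 * ‖s‖ := by
    have : ‖ξ‖ ≤ ‖s‖ + ‖s - ξ‖ := by
      simpa using norm_sub_le s (s - ξ)
    nlinarith
  have h2 : 1 / 2 * ‖s‖ ≤ ‖ξ‖ := by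
    have := norm_sub_norm_le s ξ
    nlinarith
  have hexp : inner ℝ (A s) s
      = inner ℝ (A ξ) ξ + inner ℝ (A s) (s - ξ) + inner ℝ (A (s - ξ)) ξ := by
    simp only [map_sub, inner_sub_left, inner_sub_right]
    ring
  have h3 : -(a * κ * ‖s‖ ^ 2) ≤ inner ℝ (A s) (s - ξ) := by
    refine neg_le_of_abs_le ((abs_real_inner_le_norm _ _).trans ?_)
    calc ‖A s‖ * ‖s - ξ‖ ≤ (a * ‖s‖) * (κ * ‖s‖) := by
          gcongr
          exact A.le_opNorm s
      _ = _ := by ring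
  have h4 : -(2 * (a * κ) * ‖s‖ ^ 2) ≤ inner ℝ (A (s - ξ)) ξ := by
    refine neg_le_of_abs_le ((abs_real_inner_le_norm _ _).trans ?_)
    calc ‖A (s - ξ)‖ * ‖ξ‖ ≤ (a * (κ * ‖s‖)) * (2 * ‖s‖) := by
          gcongr
          exact (A.le_opNorm _).trans (by gcongr)
      _ = _ := by ring
  have h5 := hT ξ hξ
  have h6 : (1 / 2 * ‖s‖) ^ 2 ≤ ‖ξ‖ ^ 2 := by gcongr
  have h7 : a * κ * ‖s‖ ^ 2 ≤ μ / 24 * ‖s‖ ^ 2 := by gcongr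
  rw [hexp]
  nlinarith

end InnerProductSpace

/-! ### Local expansion of the objective -/

/-- Continuity of the Hessian on the convex hull gives, near `Xs`, first- and second-order
expansions on the Stiefel manifold that use the Hessian at `Xs` only. -/
theorem exists_expansion {f : Mat n p → ℝ} (hf : Differentiable ℝ f) (hH : HessContinuous f)
    {Xs : Mat n p} (hXs : Xs ∈ St n p) {ε : ℝ} (hε : 0 < ε) :
    ∃ r > 0, ∀ X ∈ St n p, ∀ Z ∈ St n p, ‖X - Xs‖ < r → ‖Z - Xs‖ < r →
      ‖gradient f Z - gradient f X - hess f Xs (Z - X)‖ ≤ ε * ‖Z - X‖ ∧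
      |f Z - f X - inner ℝ (gradient f X) (Z - X) - 1 / 2 * inner ℝ (hess f Xs (Z - X)) (Z - X)|
        ≤ ε * ‖Z - X‖ ^ 2 := by
  have hsub : St n p ⊆ convexHull ℝ (St n p) := subset_convexHull ℝ _
  obtain ⟨r, hr, hr'⟩ := Metric.continuousWithinAt_iff.1 (hH.2 Xs (hsub hXs)) ε hε
  set K := convexHull ℝ (St n p) ∩ Metric.ball Xs r with hKdef
  have hK : Convex ℝ K := (convex_convexHull ℝ _).inter (convex_ball _ _)
  have hgrad : ∀ x ∈ K, ∀ y ∈ K,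
      ‖gradient f y - gradient f x - hess f Xs (y - x)‖ ≤ ε * ‖y - x‖ := by
    intro x hx y hy
    refine hK.norm_image_sub_le_of_norm_hasFDerivWithin_le' (f' := hess f)
      (fun z hz => ((hH.1 z hz.1).hasFDerivAt).hasFDerivWithinAt) (fun z hz => ?_) hx hy
    have := hr' hz.1 hz.2
    rw [dist_eq_norm] at this
    exact this.le
  refine ⟨r, hr, fun X hX Z hZ hXr hZr => ?_⟩
  have hXK : X ∈ K := ⟨hsub hX, by rwa [mem_ball_iff_norm]⟩
  have hZK : Z ∈ K := ⟨hsub hZ, by rwa [mem_ball_iff_norm]⟩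
  exact ⟨hgrad X hXK Z hZK, abs_taylor_sub_le hf hK hε.le hgrad hXK hZK⟩

/-- The Hessian of the objective is continuous at `Xs` along the Stiefel manifold. -/
theorem hess_tendsto {f : Mat n p → ℝ} (hH : HessContinuous f) {Xs : Mat n p} (hXs : Xs ∈ St n p)
    {X : ℕ → Mat n p} (hX : ∀ k, X k ∈ St n p) (hlim : Tendsto X atTop (𝓝 Xs)) :
    Tendsto (fun k => hess f (X k)) atTop (𝓝 (hess f Xs)) := by
  have hsub : St n p ⊆ convexHull ℝ (St n p) := subset_convexHull ℝ _
  exact (hH.2 Xs (hsub hXs)).tendsto.comp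
    (tendsto_nhdsWithin_iff.2 ⟨hlim, Eventually.of_forall fun k => hsub (hX k)⟩)

/-! ### The Lagrangian at a stationary point -/

/-- The tangent space as a real subspace. -/
def tangentSubmodule (X : Mat n p) : Submodule ℝ (Mat n p) where
  carrier := tangent X
  zero_mem' := by simp [tangent]
  add_mem' := by
    intro a b ha hb
    have ha' : Xᴴ * a + aᴴ * X = 0 := ha
    have hb' : Xᴴ * b + bᴴ * X = 0 := hb
    change Xᴴ * (a + b) + (a + b)ᴴ * X = 0
    rw [Matrix.mul_add, Matrix.conjTranspose_add, Matrix.add_mul, add_add_add_comm, ha', hb',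
      add_zero]
  smul_mem' := by
    intro c a ha
    have ha' : Xᴴ * a + aᴴ * X = 0 := ha
    change Xᴴ * (c • a) + (c • a)ᴴ * X = 0
    rw [Matrix.mul_smul, Matrix.conjTranspose_smul, Matrix.smul_mul, star_trivial, ← smul_add, ha',
      smul_zero]

/-- Right multiplication by `S` as a bounded real-linear operator. -/
noncomputable def mulRightL (S : Mat p p) : Mat n p →L[ℝ] Mat n p :=
  LinearMap.mkContinuous
    { toFun := fun ξ => ξ * S
      map_add' := fun a b => Matrix.add_mul a b S
      map_smul' := fun c a => Matrix.smul_mul c a S } ‖S‖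
    (fun ξ => (norm_mul_le' ξ S).trans_eq (mul_comm _ _))

/-- The Lagrange multiplier `sym(Xᴴ ∇f(X))` of the constraint `Xᴴ X = 1`. -/
noncomputable def multiplier (f : Mat n p → ℝ) (X : Mat n p) : Mat p p := sym (Xᴴ * gradient f X)

theorem conjTranspose_multiplier (f : Mat n p → ℝ) (X : Mat n p) :
    (multiplier f X)ᴴ = multiplier f X := conjTranspose_sym _

/-- The gradient at `X` of the Lagrangian `f - (1/2) Re ⟨S, XᴴX⟩` whose multiplier `S` is taken
at `Xs`. -/
noncomputable def lagrGrad (f : Mat n p → ℝ) (Xs X : Mat n p) : Mat n p :=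
  gradient f X - X * multiplier f Xs

/-- The Hessian of the Lagrangian at `Xs`. -/
noncomputable def lagrHess (f : Mat n p → ℝ) (Xs : Mat n p) : Mat n p →L[ℝ] Mat n p :=
  hess f Xs - mulRightL (multiplier f Xs)

theorem lagrHess_apply (f : Mat n p → ℝ) (Xs ξ : Mat n p) :
    lagrHess f Xs ξ = hess f Xs ξ - ξ * multiplier f Xs := rfl

theorem lagrGrad_self {f : Mat n p → ℝ} {Xs : Mat n p} (h : rgrad f Xs = 0) :
    lagrGrad f Xs Xs = 0 := h

/-- On the Stiefel manifold the Lagrangian and the objective have the same Riemannian gradient. -/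
theorem rgrad_eq_proj_lagrGrad (f : Mat n p → ℝ) (Xs : Mat n p) {X : Mat n p} (hX : X ∈ St n p) :
    rgrad f X = proj X (lagrGrad f Xs X) := by
  rw [lagrGrad, proj_sub, proj_mul_of_conjTranspose_eq hX (conjTranspose_multiplier f Xs), sub_zero,
    rgrad]

/-- On chords of the Stiefel manifold the second-order expansions of the objective and of the
Lagrangian agree. -/
theorem inner_gradient_add_hess_chord (f : Mat n p → ℝ) (Xs : Mat n p) {X Z : Mat n p}
    (hX : X ∈ St n p) (hZ : Z ∈ St n p) :
    inner ℝ (gradient f X) (Z - X) + 1 / 2 * inner ℝ (hess f Xs (Z - X)) (Z - X)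
      = inner ℝ (lagrGrad f Xs X) (Z - X)
        + 1 / 2 * inner ℝ (lagrHess f Xs (Z - X)) (Z - X) := by
  rw [lagrHess_apply, lagrGrad, inner_sub_left, inner_sub_left,
    inner_mul_chord hX hZ (conjTranspose_multiplier f Xs)]
  ring

theorem inner_rhess (f : Mat n p → ℝ) (X : Mat n p) {ξ : Mat n p} (hξ : ξ ∈ tangent X) :
    inner ℝ (rhess f X ξ) ξ = inner ℝ (lagrHess f X ξ) ξ := by
  rw [rhess, inner_proj_left, proj_of_mem_tangent hξ]
  rfl

/-- The Hessian of the Lagrangian is uniformly positive on short chords near `Xs`. -/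
theorem exists_chord_coercive {f : Mat n p → ℝ} {Xs : Mat n p} (hXs : Xs ∈ St n p)
    (hpos : RHessPosDef f Xs) :
    ∃ μ > 0, ∃ r > 0, ∀ X ∈ St n p, ∀ Z ∈ St n p, ‖X - Xs‖ < r → ‖Z - Xs‖ < r →
      μ * ‖Z - X‖ ^ 2 ≤ inner ℝ (lagrHess f Xs (Z - X)) (Z - X) := by
  obtain ⟨κ, hκ, μ, hμ, h⟩ := exists_coercive_near_submodule (tangentSubmodule Xs) (lagrHess f Xs)
    (fun ξ hξ h0 => by
      rw [← inner_rhess f Xs hξ]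
      exact hpos ξ hξ h0)
  refine ⟨μ, hμ, κ / (3 * (‖Xs‖ + 1)), by positivity, fun X hX Z hZ hXr hZr => ?_⟩
  refine h _ ⟨proj Xs (Z - X), proj_mem_tangent hXs _, ?_⟩
  refine (norm_chord_sub_proj_le hX hZ).trans ?_
  gcongr
  have h1 : ‖Z - X‖ ≤ ‖Z - Xs‖ + ‖X - Xs‖ := by
    simpa using norm_sub_le (Z - Xs) (X - Xs)
  rw [lt_div_iff₀ (by positivity)] at hXr hZr
  nlinarith [norm_nonneg Xs, norm_nonneg (X - Xs), norm_nonneg (Z - Xs)]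

/-- Near a nondegenerate minimizer the gradients measure the distance to it. -/
theorem exists_error_bound {f : Mat n p → ℝ} (hf : Differentiable ℝ f) (hH : HessContinuous f)
    {Xs : Mat n p} (hXs : Xs ∈ St n p) (hstat : rgrad f Xs = 0) (hpos : RHessPosDef f Xs) :
    ∃ C > 0, ∃ r > 0, ∀ X ∈ St n p, ‖X - Xs‖ < r →
      ‖lagrGrad f Xs X‖ ≤ C * ‖X - Xs‖ ∧ ‖rgrad f X‖ ≤ C * ‖X - Xs‖ ∧
        ‖X - Xs‖ ≤ C * ‖rgrad f X‖ := by
  obtain ⟨μ, hμ, r₁, hr₁, hco⟩ := exists_chord_coercive hXs hpos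
  obtain ⟨r₂, hr₂, hex⟩ := exists_expansion hf hH hXs (half_pos hμ)
  set a := ‖lagrHess f Xs‖ + μ / 2 with ha
  have ha0 : 0 < a := by positivity
  set C := (1 + p) * a + 4 / μ * (1 + p) with hC
  have hp : (0 : ℝ) ≤ p := Nat.cast_nonneg p
  have haC : a ≤ C := by
    have : 0 ≤ 4 / μ * (1 + p) := by positivity
    nlinarith
  have haC' : (1 + p) * a ≤ C := by
    have : 0 ≤ 4 / μ * (1 + p) := by positivity
    linarith
  refine ⟨C, by positivity, min (min r₁ r₂) (μ / (4 * (a * (p + 1)))), by positivity,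
    fun X hX hXr => ?_⟩
  obtain ⟨hX2, hX3⟩ := lt_min_iff.1 hXr
  obtain ⟨hXr₁, hXr₂⟩ := lt_min_iff.1 hX2
  set D := X - Xs with hD
  have hlin : ‖lagrGrad f Xs X - lagrHess f Xs D‖ ≤ μ / 2 * ‖D‖ := by
    have h1 := (hex Xs hXs X hX (by simpa using hr₂) hXr₂).1
    have h2 : lagrGrad f Xs X - lagrHess f Xs D
        = gradient f X - gradient f Xs - hess f Xs (X - Xs) + lagrGrad f Xs Xs := by
      rw [lagrHess_apply, lagrGrad, lagrGrad, hD, Matrix.sub_mul]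
      abel
    rwa [h2, lagrGrad_self hstat, add_zero]
  have hup : ‖lagrGrad f Xs X‖ ≤ a * ‖D‖ := by
    have h1 := norm_add_le (lagrGrad f Xs X - lagrHess f Xs D) (lagrHess f Xs D)
    rw [sub_add_cancel] at h1
    have h2 := (lagrHess f Xs).le_opNorm D
    rw [ha]
    linarith
  have hD0 := norm_nonneg D
  refine ⟨hup.trans (by gcongr), ?_, ?_⟩
  · rw [rgrad_eq_proj_lagrGrad f Xs hX]
    calc _ ≤ _ := norm_proj_le hX _
      _ ≤ (1 + p) * (a * ‖D‖) := by gcongr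
      _ = (1 + p) * a * ‖D‖ := by ring
      _ ≤ _ := by gcongr
  · -- Test the gradient of the Lagrangian against the chord `D`, whose normal part at `X` is
    -- quadratically small.
    have h1 : μ / 2 * ‖D‖ ^ 2 ≤ inner ℝ (lagrGrad f Xs X) D := by
      have h2 := hco Xs hXs X hX (by simpa using hr₁) hXr₁
      have h3 := neg_le_of_abs_le (abs_real_inner_le_norm (lagrGrad f Xs X - lagrHess f Xs D) D)
      rw [inner_sub_left] at h3
      nlinarith
    have h4 : inner ℝ (lagrGrad f Xs X) D
        = inner ℝ (rgrad f X) D + inner ℝ (lagrGrad f Xs X) (D - proj X D) := by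
      rw [rgrad_eq_proj_lagrGrad f Xs hX, inner_proj_left, inner_sub_right _ D, add_sub_cancel]
    have h5 : ‖D - proj X D‖ ≤ (p + 1) * ‖D‖ ^ 2 := by
      have h6 : D - proj X D = -((Xs - X) - proj X (Xs - X)) := by
        have : D = 0 - (Xs - X) := by rw [hD]; abel
        rw [this, proj_sub]
        have h0 : proj X 0 = 0 := by simp [proj, sym]
        rw [h0]
        abel
      have h7 := norm_chord_sub_proj_le (Xs := X) hX hXs
      rw [h6, norm_neg]
      refine h7.trans ?_
      rw [sub_self, norm_zero, add_zero, norm_sub_rev Xs X, mul_assoc, ← pow_two]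
      gcongr
      nlinarith [norm_of_mem_St hX, sq_nonneg (‖X‖ - 1)]
    have h6 : inner ℝ (lagrGrad f Xs X) (D - proj X D) ≤ μ / 4 * ‖D‖ ^ 2 := by
      rw [lt_div_iff₀ (by positivity)] at hX3
      calc _ ≤ _ := real_inner_le_norm _ _
        _ ≤ (a * ‖D‖) * ((p + 1) * ‖D‖ ^ 2) := by gcongr
        _ = (‖D‖ * (a * (p + 1))) * ‖D‖ ^ 2 := by ring
        _ ≤ _ := by
          gcongr
          linarith
    have h7 : μ / 4 * ‖D‖ ^ 2 ≤ ‖rgrad f X‖ * ‖D‖ := by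
      have := real_inner_le_norm (rgrad f X) D
      linarith
    have h8 : ‖D‖ ≤ 4 / μ * ‖rgrad f X‖ := by
      rcases hD0.eq_or_lt with h0 | h0
      · rw [← h0]
        positivity
      · have : μ / 4 * ‖D‖ ≤ ‖rgrad f X‖ := by
          refine le_of_mul_le_mul_right ?_ h0
          linarith
        rw [div_mul_eq_mul_div, le_div_iff₀ hμ]
        linarith
    refine h8.trans ?_
    gcongr
    have : 0 ≤ 4 / μ := by positivity
    nlinarith [mul_nonneg hp ha0.le]

/-! ### Geodesic and Frobenius distance -/

/-- A Hermitian matrix is a real combination of orthogonal rank-one projections. -/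
theorem exists_spectral_projections {A : Mat p p} (hA : Aᴴ = A) :
    ∃ (l : Fin p → ℝ) (P : Fin p → Mat p p), (∀ i j, P i * P j = if i = j then P i else 0) ∧
      (∀ i, (P i)ᴴ = P i) ∧ (∀ i, ‖P i‖ = 1) ∧ ∑ i, P i = 1 ∧ A = ∑ i, l i • P i := by
  have hH : Matrix.IsHermitian A := hA
  set U : Mat p p := hH.eigenvectorUnitary.1 with hU
  have hUU : Uᴴ * U = 1 := Unitary.coe_star_mul_self hH.eigenvectorUnitary
  have hUU' : U * Uᴴ = 1 := Unitary.coe_mul_star_self hH.eigenvectorUnitary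
  have hsp : A = U * Matrix.diagonal (fun i => (hH.eigenvalues i : ℂ)) * Uᴴ := hH.spectral_theorem
  set E : Fin p → Mat p p := fun i => Matrix.single i i 1 with hE
  have hmul : ∀ i j, (U * E i * Uᴴ) * (U * E j * Uᴴ) = if i = j then U * E i * Uᴴ else 0 := by
    intro i j
    have : (U * E i * Uᴴ) * (U * E j * Uᴴ) = U * (E i * E j) * Uᴴ := by
      simp only [Matrix.mul_assoc]
      rw [← Matrix.mul_assoc Uᴴ U, hUU, Matrix.one_mul]
    rw [this]
    split_ifs with h
    · subst h
      simp [hE]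
    · simp [hE, h]
  have hherm : ∀ i, (U * E i * Uᴴ)ᴴ = U * E i * Uᴴ := by
    intro i
    simp [hE, Matrix.mul_assoc]
  refine ⟨hH.eigenvalues, fun i => U * E i * Uᴴ, hmul, hherm, fun i => ?_, ?_, ?_⟩
  · have h1 : ‖U * E i * Uᴴ‖ ^ 2 = 1 := by
      rw [← re_trace_conjTranspose_mul_self, hherm, hmul, if_pos rfl, Matrix.trace_mul_comm,
        ← Matrix.mul_assoc, hUU, Matrix.one_mul]
      simp [hE]
    exact (pow_eq_one_iff_of_nonneg (norm_nonneg _) two_ne_zero).1 h1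
  · rw [← Finset.sum_mul, ← Finset.mul_sum]
    have : ∑ i, E i = 1 := by
      rw [hE, ← Matrix.diagonal_one]
      exact (Matrix.sum_single_eq_diagonal 1)
    rw [this, Matrix.mul_one, hUU']
  · nth_rewrite 1 [hsp]
    rw [← Matrix.sum_single_eq_diagonal, Matrix.mul_sum, Matrix.sum_mul]
    refine Finset.sum_congr rfl fun i _ => ?_
    rw [← Matrix.smul_mul, ← Matrix.mul_smul, hE, Matrix.smul_single]
    simp

theorem sum_smul_mul_sum_smul {P : Fin p → Mat p p}
    (hP : ∀ i j, P i * P j = if i = j then P i else 0) (a b : Fin p → ℝ) :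
    (∑ i, a i • P i) * ∑ i, b i • P i = ∑ i, (a i * b i) • P i := by
  rw [Matrix.sum_mul]
  refine Finset.sum_congr rfl fun i _ => ?_
  rw [Matrix.mul_sum, Finset.sum_eq_single i]
  · rw [Matrix.smul_mul, Matrix.mul_smul, hP, if_pos rfl, smul_smul]
  · intro j _ hj
    rw [Matrix.smul_mul, Matrix.mul_smul, hP, if_neg hj.symm, smul_zero, smul_zero]
  · simp

/-- The scalar factor that normalizes the chord `X + t D` in an eigendirection of `Dᴴ D` with
eigenvalue `l`. -/
noncomputable def chordFactor (l t : ℝ) : ℝ := (√(1 - t * (1 - t) * l))⁻¹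

theorem three_quarters_le_one_sub {l : ℝ} (hl0 : 0 ≤ l) (hl1 : l ≤ 1) (t : ℝ) :
    3 / 4 ≤ 1 - t * (1 - t) * l := by
  nlinarith [sq_nonneg (t - 1 / 2), mul_nonneg hl0 (sq_nonneg (t - 1 / 2))]

theorem contDiff_chordFactor {l : ℝ} (hl0 : 0 ≤ l) (hl1 : l ≤ 1) :
    ContDiff ℝ 1 (chordFactor l) := by
  have h := fun t => three_quarters_le_one_sub hl0 hl1 t
  have h1 : ContDiff ℝ 1 fun t : ℝ => 1 - t * (1 - t) * l := by fun_prop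
  refine (h1.sqrt fun t => ?_).inv fun t => ?_
  · linarith [h t]
  · exact (Real.sqrt_pos.2 (by linarith [h t])).ne'

theorem three_quarters_le_sqrt_one_sub {l : ℝ} (hl0 : 0 ≤ l) (hl1 : l ≤ 1) (t : ℝ) :
    3 / 4 ≤ √(1 - t * (1 - t) * l) :=
  Real.le_sqrt_of_sq_le (by linarith [three_quarters_le_one_sub hl0 hl1 t])

theorem abs_chordFactor_le {l : ℝ} (hl0 : 0 ≤ l) (hl1 : l ≤ 1) (t : ℝ) :
    |chordFactor l t| ≤ 2 := by
  have h := three_quarters_le_sqrt_one_sub hl0 hl1 t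
  rw [chordFactor, abs_inv, abs_of_nonneg (Real.sqrt_nonneg _)]
  exact inv_le_of_inv_le₀ (by norm_num) (by linarith)

theorem abs_deriv_chordFactor_le {l : ℝ} (hl0 : 0 ≤ l) (hl1 : l ≤ 1) {t : ℝ}
    (ht : t ∈ Icc (0 : ℝ) 1) : |deriv (chordFactor l) t| ≤ l := by
  have hu := three_quarters_le_one_sub hl0 hl1 t
  have hs := three_quarters_le_sqrt_one_sub hl0 hl1 t
  have h1 : HasDerivAt (fun t : ℝ => 1 - t * (1 - t) * l) (-((1 - 2 * t) * l)) t := by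
    have := (((hasDerivAt_id t).mul ((hasDerivAt_id t).const_sub 1)).mul_const l).const_sub 1
    refine this.congr_deriv ?_
    simp only [id_eq]
    ring
  have h2 := (h1.sqrt (by linarith)).fun_inv (by positivity)
  have h3 : deriv (chordFactor l) t = _ := h2.deriv
  rw [h3, abs_div, abs_neg, abs_div, abs_neg, abs_mul, abs_of_nonneg hl0]
  have h4 : |1 - 2 * t| ≤ 1 := abs_le.2 ⟨by linarith [ht.2], by linarith [ht.1]⟩
  rw [abs_of_pos (show 0 < 2 * √(1 - t * (1 - t) * l) by positivity),
    abs_of_pos (show 0 < √(1 - t * (1 - t) * l) ^ 2 by positivity), div_div,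
    div_le_iff₀ (by positivity)]
  have h5 : 1 ≤ 2 * √(1 - t * (1 - t) * l) * √(1 - t * (1 - t) * l) ^ 2 := by
    rw [Real.sq_sqrt (by linarith)]
    nlinarith
  calc |1 - 2 * t| * l ≤ 1 * l := by gcongr
    _ = l * 1 := by ring
    _ ≤ _ := by gcongr

/-- Nearby points of the Stiefel manifold are joined inside it by the normalized chord, whose
speed is comparable to the Frobenius distance. Writing `Y = X + t D`, one has
`Yᴴ Y = 1 - t (1 - t) Dᴴ D`, so `Y (Yᴴ Y)^(-1/2)` only involves functions of the single Hermitian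
matrix `Dᴴ D`. -/
theorem exists_curve {X Z : Mat n p} (hX : X ∈ St n p) (hZ : Z ∈ St n p) (hD : ‖Z - X‖ ≤ 1) :
    ∃ γ : ℝ → Mat n p, ContDiff ℝ 1 γ ∧ (∀ t, γ t ∈ St n p) ∧ γ 0 = X ∧ γ 1 = Z ∧
      ∀ t ∈ Icc (0 : ℝ) 1, ‖deriv γ t‖ ≤ p * (‖X‖ + 3) * ‖Z - X‖ := by
  set D := Z - X with hDdef
  obtain ⟨l, P, hP, hPH, hP1, hPs, hA⟩ := exists_spectral_projections (A := Dᴴ * D) (by simp)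
  have hl : ∀ i, l i = ‖D * P i‖ ^ 2 := by
    intro i
    have h1 : (D * P i)ᴴ * (D * P i) = l i • P i := by
      rw [Matrix.conjTranspose_mul, hPH, Matrix.mul_assoc, ← Matrix.mul_assoc Dᴴ, hA,
        Matrix.sum_mul, Finset.sum_eq_single i, Matrix.smul_mul, Matrix.mul_smul, hP, if_pos rfl,
        hP, if_pos rfl]
      · intro j _ hj
        rw [Matrix.smul_mul, hP, if_neg hj, smul_zero]
      · simp
    have h2 : (Matrix.trace (P i)).re = 1 := by
      have := re_trace_conjTranspose_mul_self (P i)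
      rwa [hPH, hP, if_pos rfl, hP1, one_pow] at this
    rw [← re_trace_conjTranspose_mul_self, h1, Matrix.trace_smul, Complex.smul_re, h2, smul_eq_mul,
      mul_one]
  have hDP : ∀ i, ‖D * P i‖ ≤ ‖D‖ := fun i => by
    simpa [hP1] using norm_mul_le' D (P i)
  have hl0 : ∀ i, 0 ≤ l i := fun i => by
    rw [hl]
    positivity
  have hlD : ∀ i, l i ≤ ‖D‖ := fun i => by
    rw [hl]
    nlinarith [hDP i, norm_nonneg (D * P i)]
  have hl1 : ∀ i, l i ≤ 1 := fun i => (hlD i).trans hD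
  set W : ℝ → Mat p p := fun t => ∑ i, chordFactor (l i) t • P i with hW
  have hWH : ∀ t, (W t)ᴴ = W t := fun t => by
    simp [hW, Matrix.conjTranspose_sum, Matrix.conjTranspose_smul, hPH]
  have hgram : ∀ t : ℝ, (X + t • D)ᴴ * (X + t • D) = ∑ i, (1 - t * (1 - t) * l i) • P i := by
    intro t
    have h1 : ∑ i, (1 - t * (1 - t) * l i) • P i = 1 - (t * (1 - t)) • (Dᴴ * D) := by
      simp only [sub_smul, one_smul, Finset.sum_sub_distrib, hPs, mul_smul, ← Finset.smul_sum, ← hA]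
    have h2 : Xᴴ * D + Dᴴ * X = -(Dᴴ * D) := conjTranspose_mul_chord hX hZ
    have h3 : (X + t • D)ᴴ * (X + t • D)
        = Xᴴ * X + t • (Xᴴ * D + Dᴴ * X) + (t * t) • (Dᴴ * D) := by
      simp only [Matrix.conjTranspose_add, Matrix.conjTranspose_smul, star_trivial, Matrix.add_mul,
        Matrix.mul_add, Matrix.smul_mul, Matrix.mul_smul, smul_smul, smul_add]
      abel
    rw [h1, h3, h2, show Xᴴ * X = 1 from hX]
    module
  have hsum : ∀ t : ℝ, (X + t • D) * W t = ∑ i, chordFactor (l i) t • ((X + t • D) * P i) := by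
    intro t
    simp only [hW, Matrix.mul_sum, Matrix.mul_smul]
  have hend : ∀ t : ℝ, t * (1 - t) = 0 → W t = 1 := by
    intro t ht
    simp [hW, chordFactor, ht, hPs]
  have hline : ∀ i, ∀ t : ℝ, (X + t • D) * P i = X * P i + t • (D * P i) := fun i t => by
    rw [Matrix.add_mul, Matrix.smul_mul]
  have hγ : (fun t : ℝ => (X + t • D) * W t)
      = fun t => ∑ i, chordFactor (l i) t • (X * P i + t • (D * P i)) := by
    funext t
    rw [hsum]
    simp only [hline]
  refine ⟨fun t => (X + t • D) * W t, ?_, fun t => ?_, ?_, ?_, fun t ht => ?_⟩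
  · rw [hγ]
    refine ContDiff.sum fun i _ => (contDiff_chordFactor (hl0 i) (hl1 i)).smul ?_
    fun_prop
  · change ((X + t • D) * W t)ᴴ * ((X + t • D) * W t) = 1
    rw [Matrix.conjTranspose_mul, hWH, Matrix.mul_assoc, ← Matrix.mul_assoc _ _ (W t), hgram,
      sum_smul_mul_sum_smul hP, sum_smul_mul_sum_smul hP, ← hPs]
    refine Finset.sum_congr rfl fun i _ => ?_
    have h1 := three_quarters_le_one_sub (hl0 i) (hl1 i) t
    have h2 := Real.mul_self_sqrt (show 0 ≤ 1 - t * (1 - t) * l i by linarith)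
    have h3 := three_quarters_le_sqrt_one_sub (hl0 i) (hl1 i) t
    rw [chordFactor]
    set u := √(1 - t * (1 - t) * l i)
    have hu : u ≠ 0 := by
      rintro h0
      norm_num [h0] at h3
    rw [← h2]
    have : u⁻¹ * (u * u * u⁻¹) = 1 := by field_simp
    rw [this, one_smul]
  · simp [hend]
  · simp [hend, hDdef]
  · have hder : HasDerivAt (fun t : ℝ => (X + t • D) * W t)
        (∑ i, (chordFactor (l i) t • (D * P i)
          + deriv (chordFactor (l i)) t • (X * P i + t • (D * P i)))) t := by
      rw [hγ]
      refine HasDerivAt.fun_sum fun i _ => ?_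
      have h1 : HasDerivAt (chordFactor (l i)) (deriv (chordFactor (l i)) t) t :=
        ((contDiff_chordFactor (hl0 i) (hl1 i)).differentiable one_ne_zero t).hasDerivAt
      have h2 : HasDerivAt (fun t : ℝ => X * P i + t • (D * P i)) (D * P i) t := by
        simpa using ((hasDerivAt_id t).smul_const (D * P i)).const_add (X * P i)
      exact h1.smul h2
    rw [hder.deriv]
    refine (norm_sum_le _ _).trans ?_
    have hb : ∀ i ∈ (Finset.univ : Finset (Fin p)),
        ‖chordFactor (l i) t • (D * P i)
          + deriv (chordFactor (l i)) t • (X * P i + t • (D * P i))‖ ≤ (‖X‖ + 3) * ‖D‖ := by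
      intro i _
      have h1 : ‖X * P i + t • (D * P i)‖ ≤ ‖X‖ + 1 := by
        refine (norm_add_le _ _).trans (add_le_add ?_ ?_)
        · simpa [hP1] using norm_mul_le' X (P i)
        · rw [norm_smul, Real.norm_of_nonneg ht.1]
          exact mul_le_one₀ ht.2 (norm_nonneg _) ((hDP i).trans hD)
      calc _ ≤ _ := norm_add_le _ _
        _ ≤ 2 * ‖D‖ + ‖D‖ * (‖X‖ + 1) := by
          rw [norm_smul, norm_smul, Real.norm_eq_abs, Real.norm_eq_abs]
          gcongr
          · exact abs_chordFactor_le (hl0 i) (hl1 i) t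
          · exact hDP i
          · exact (abs_deriv_chordFactor_le (hl0 i) (hl1 i) ht).trans (hlD i)
        _ = _ := by ring
    refine (Finset.sum_le_card_nsmul _ _ _ hb).trans_eq ?_
    simp
    ring

/-- Locally the geodesic distance is equivalent to the Frobenius distance. -/
theorem norm_sub_le_geodDist_le {X Z : Mat n p} (hX : X ∈ St n p) (hZ : Z ∈ St n p)
    (hD : ‖Z - X‖ ≤ 1) :
    ‖Z - X‖ ≤ geodDist X Z ∧ geodDist X Z ≤ p * (‖X‖ + 3) * ‖Z - X‖ := by
  obtain ⟨γ, hγ, hγS, h0, h1, hb⟩ := exists_curve hX hZ hD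
  have hmem : (∫ t in (0 : ℝ)..1, ‖derivWithin γ (Icc 0 1) t‖) ∈
      {L : ℝ | ∃ γ : ℝ → Mat n p, ContDiffOn ℝ 1 γ (Icc 0 1) ∧
        (∀ t ∈ Icc (0 : ℝ) 1, γ t ∈ St n p) ∧ γ 0 = X ∧ γ 1 = Z ∧
        L = ∫ t in (0 : ℝ)..1, ‖derivWithin γ (Icc 0 1) t‖} :=
    ⟨γ, hγ.contDiffOn, fun t _ => hγS t, h0, h1, rfl⟩
  constructor
  · refine le_csInf ⟨_, hmem⟩ ?_
    rintro L ⟨c, hc, -, hc0, hc1, rfl⟩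
    have h2 := intervalIntegral.integral_derivWithin_Icc_of_contDiffOn_Icc hc zero_le_one
    rw [← hc0, ← hc1, ← h2]
    exact intervalIntegral.norm_integral_le_integral_norm zero_le_one
  · refine (csInf_le ⟨0, ?_⟩ hmem).trans ?_
    · rintro L ⟨c, -, -, -, -, rfl⟩
      exact intervalIntegral.integral_nonneg zero_le_one fun t _ => norm_nonneg _
    · have h2 : ∀ t ∈ uIoc (0 : ℝ) 1, ‖‖derivWithin γ (Icc 0 1) t‖‖ ≤ p * (‖X‖ + 3) * ‖Z - X‖ := by
        intro t ht
        rw [uIoc_of_le zero_le_one] at ht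
        have ht' : t ∈ Icc (0 : ℝ) 1 := ⟨ht.1.le, ht.2⟩
        have h3 : HasDerivAt γ (deriv γ t) t := (hγ.differentiable one_ne_zero t).hasDerivAt
        rw [norm_norm, h3.hasDerivWithinAt.derivWithin (uniqueDiffOn_Icc_zero_one t ht')]
        exact hb t ht'
      have h3 := intervalIntegral.norm_integral_le_of_norm_le_const h2
      rw [sub_zero, abs_one, mul_one] at h3
      exact (le_abs_self _).trans h3

/-! ### The regularized model -/

/-- The factor by which the gradient of `(1/2) d(·, Y)` at `X` stretches `X - Y`, as a function of
`‖X - Y‖`. -/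
def Regularization.weight (reg : Regularization) (t : ℝ) : ℝ :=
  match reg with
  | .quadratic => 1
  | .cubic => t

theorem Regularization.weight_mem_Icc (reg : Regularization) {t : ℝ} (ht : t ∈ Icc (0 : ℝ) 1) :
    reg.weight t ∈ Icc (0 : ℝ) 1 := by
  cases reg
  · simp [Regularization.weight]
  · exact ht

theorem Regularization.dist_nonneg (reg : Regularization) (X Y : Mat n p) : 0 ≤ reg.dist X Y := by
  cases reg <;> simp only [Regularization.dist] <;> positivity

theorem Regularization.hasFDerivAt_dist (reg : Regularization) (Y Z : Mat n p) :
    HasFDerivAt (fun X => reg.dist X Y) ((2 * reg.weight ‖Z - Y‖) • innerSL ℝ (Z - Y)) Z := by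
  have h0 : HasFDerivAt (fun X : Mat n p => X - Y) (ContinuousLinearMap.id ℝ (Mat n p)) Z :=
    (hasFDerivAt_id Z).sub_const Y
  cases reg
  · have h := h0.norm_sq
    refine h.congr_fderiv ?_
    ext v
    simp [Regularization.weight]
  · have h := ((hasFDerivAt_norm_rpow (Z - Y) (p := 3) (by norm_num)).comp Z h0).const_mul
      (2 / 3 : ℝ)
    have he : (fun X : Mat n p => Regularization.cubic.dist X Y)
        = fun X => 2 / 3 * ((fun x : Mat n p => ‖x‖ ^ (3 : ℝ)) ∘ fun X => X - Y) X := by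
      funext X
      simp only [Regularization.dist, Function.comp]
      norm_cast
    rw [he]
    refine h.congr_fderiv ?_
    ext v
    have h1 : ‖Z - Y‖ ^ ((3 : ℝ) - 2) = ‖Z - Y‖ := by norm_num
    simp only [smul_apply, ContinuousLinearMap.comp_apply,
      ContinuousLinearMap.id_apply, Regularization.weight, smul_eq_mul, h1]
    ring

theorem gradient_model (f : Mat n p → ℝ) (reg : Regularization) {B : Mat n p →L[ℝ] Mat n p}
    (hB : ∀ U V, inner ℝ (B U) V = inner ℝ U (B V)) (τ : ℝ) (Y Z : Mat n p) :
    gradient (model f reg B τ Y) Z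
      = gradient f Y + B (Z - Y) + (τ * reg.weight ‖Z - Y‖) • (Z - Y) := by
  refine HasGradientAt.gradient ?_
  rw [hasGradientAt_iff_hasFDerivAt]
  have h0 : HasFDerivAt (fun X : Mat n p => X - Y) (ContinuousLinearMap.id ℝ (Mat n p)) Z :=
    (hasFDerivAt_id Z).sub_const Y
  have h1 : HasFDerivAt (fun X : Mat n p => inner ℝ (gradient f Y) (X - Y))
      ((innerSL ℝ (gradient f Y)).comp (ContinuousLinearMap.id ℝ (Mat n p))) Z :=
    (innerSL ℝ (gradient f Y)).hasFDerivAt.comp Z h0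
  have h2 := ((B.hasFDerivAt.comp Z h0).inner ℝ h0).const_mul (1 / 2 : ℝ)
  have h3 := (reg.hasFDerivAt_dist Y Z).const_mul (τ / 2)
  refine ((h1.add h2).add h3).congr_fderiv ?_
  ext v
  simp only [add_apply, smul_apply,
    ContinuousLinearMap.comp_apply, ContinuousLinearMap.id_apply, fderivInnerCLM_apply,
    ContinuousLinearMap.prod_apply, innerSL_apply_apply, InnerProductSpace.toDual_apply_apply,
    smul_eq_mul, Function.comp_apply, hB v, real_inner_comm v]
  rw [inner_add_right, inner_add_right, inner_smul_right]
  ring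

/-- The model along a chord, in terms of the Lagrangian and of the Hessian error `B - ∇²f(Xs)`. -/
theorem model_chord (f : Mat n p → ℝ) (reg : Regularization) (B : Mat n p →L[ℝ] Mat n p) (τ : ℝ)
    (Xs : Mat n p) {X Z : Mat n p} (hX : X ∈ St n p) (hZ : Z ∈ St n p) :
    model f reg B τ X Z = inner ℝ (lagrGrad f Xs X) (Z - X)
      + 1 / 2 * inner ℝ (lagrHess f Xs (Z - X)) (Z - X)
      + 1 / 2 * inner ℝ ((B - hess f Xs) (Z - X)) (Z - X) + τ / 2 * reg.dist Z X := by
  rw [model, ← inner_gradient_add_hess_chord f Xs hX hZ, sub_apply,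
    inner_sub_left]
  ring

/-- A step that does not increase the model is controlled by the gradient of the Lagrangian, as
the model is uniformly convex along short chords. -/
theorem norm_step_le {f : Mat n p → ℝ} {reg : Regularization} {B : Mat n p →L[ℝ] Mat n p} {τ : ℝ}
    (hτ : 0 ≤ τ) {Xs X Z : Mat n p} (hX : X ∈ St n p) (hZ : Z ∈ St n p) {μ : ℝ}
    (hco : μ * ‖Z - X‖ ^ 2 ≤ inner ℝ (lagrHess f Xs (Z - X)) (Z - X))
    (hB : ‖(B - hess f Xs) (Z - X)‖ ≤ μ / 2 * ‖Z - X‖)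
    (hm : model f reg B τ X Z ≤ 0) :
    μ / 4 * ‖Z - X‖ ≤ ‖lagrGrad f Xs X‖ := by
  rw [model_chord f reg B τ Xs hX hZ] at hm
  have h1 := neg_le_of_abs_le (abs_real_inner_le_norm (lagrGrad f Xs X) (Z - X))
  have h2 := neg_le_of_abs_le (abs_real_inner_le_norm ((B - hess f Xs) (Z - X)) (Z - X))
  have h3 : 0 ≤ τ / 2 * reg.dist Z X := mul_nonneg (by linarith) (reg.dist_nonneg Z X)
  have h4 : ‖(B - hess f Xs) (Z - X)‖ * ‖Z - X‖ ≤ μ / 2 * ‖Z - X‖ * ‖Z - X‖ := by gcongr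
  rcases (norm_nonneg (Z - X)).eq_or_lt with h0 | h0
  · rw [← h0]
    simp
  · refine le_of_mul_le_mul_right ?_ h0
    nlinarith

/-- Up to `o(‖Z - X‖²)` the objective decreases at least as much as the model; the regularization
term only helps. -/
theorem sub_le_model_add {f : Mat n p → ℝ} {reg : Regularization} {B : Mat n p →L[ℝ] Mat n p}
    {τ : ℝ} (hτ : 0 ≤ τ) {Xs X Z : Mat n p} {ε : ℝ}
    (htaylor : |f Z - f X - inner ℝ (gradient f X) (Z - X)
      - 1 / 2 * inner ℝ (hess f Xs (Z - X)) (Z - X)| ≤ ε * ‖Z - X‖ ^ 2)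
    (hB : ‖(B - hess f Xs) (Z - X)‖ ≤ ε * ‖Z - X‖) :
    f Z - f X ≤ model f reg B τ X Z + 2 * ε * ‖Z - X‖ ^ 2 := by
  have h1 := le_of_abs_le htaylor
  have h2 := neg_le_of_abs_le (abs_real_inner_le_norm ((B - hess f Xs) (Z - X)) (Z - X))
  have h3 : 0 ≤ τ / 2 * reg.dist Z X := mul_nonneg (by linarith) (reg.dist_nonneg Z X)
  have h4 : ‖(B - hess f Xs) (Z - X)‖ * ‖Z - X‖ ≤ ε * ‖Z - X‖ * ‖Z - X‖ := by gcongr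
  have h5 : 0 ≤ ‖(B - hess f Xs) (Z - X)‖ * ‖Z - X‖ := by positivity
  rw [sub_apply, inner_sub_left] at h2
  rw [sub_apply] at h4 h5
  rw [model]
  nlinarith

/-- The Riemannian gradients of the objective and of the model at the trial point differ by
`o(‖Z - X‖)`, once `τ` is small. -/
theorem norm_rgrad_trial_le {f : Mat n p → ℝ} {reg : Regularization} {B : Mat n p →L[ℝ] Mat n p}
    (hsymm : ∀ U V, inner ℝ (B U) V = inner ℝ U (B V)) {τ : ℝ} (hτ : 0 ≤ τ) {Xs X Z : Mat n p}
    (hZ : Z ∈ St n p) {ε : ℝ}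
    (hgrad : ‖gradient f Z - gradient f X - hess f Xs (Z - X)‖ ≤ ε * ‖Z - X‖)
    (hB : ‖(B - hess f Xs) (Z - X)‖ ≤ ε * ‖Z - X‖) (hs : ‖Z - X‖ ≤ 1) :
    ‖rgrad f Z‖ ≤ ‖rgrad (model f reg B τ X) Z‖ + (1 + p) * (2 * ε + τ) * ‖Z - X‖ := by
  have h1 : gradient f Z - gradient (model f reg B τ X) Z
      = (gradient f Z - gradient f X - hess f Xs (Z - X)) - (B - hess f Xs) (Z - X)
        - (τ * reg.weight ‖Z - X‖) • (Z - X) := by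
    rw [gradient_model f reg hsymm, sub_apply]
    abel
  have hw := reg.weight_mem_Icc ⟨norm_nonneg _, hs⟩
  have h2 : ‖(τ * reg.weight ‖Z - X‖) • (Z - X)‖ ≤ τ * ‖Z - X‖ := by
    rw [norm_smul, Real.norm_of_nonneg (mul_nonneg hτ hw.1)]
    gcongr
    exact mul_le_of_le_one_right hτ hw.2
  have h3 : ‖gradient f Z - gradient (model f reg B τ X) Z‖ ≤ (2 * ε + τ) * ‖Z - X‖ := by
    rw [h1]
    refine (norm_sub_le _ _).trans ?_
    have := norm_sub_le (gradient f Z - gradient f X - hess f Xs (Z - X))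
      ((B - hess f Xs) (Z - X))
    linarith
  have h4 : rgrad f Z = rgrad (model f reg B τ X) Z
      + proj Z (gradient f Z - gradient (model f reg B τ X) Z) := by
    rw [proj_sub, rgrad, rgrad]
    abel
  rw [h4]
  refine (norm_add_le _ _).trans ?_
  gcongr
  refine (norm_proj_le hZ _).trans ?_
  rw [mul_assoc]
  gcongr

/-! ### Asymptotics of a run -/

section Run

variable {f : Mat n p → ℝ} {reg : Regularization} {P : Params} {X Z : ℕ → Mat n p}
  {B : ℕ → Mat n p →L[ℝ] Mat n p} {τ : ℕ → ℝ} {Xs : Mat n p}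

theorem IsRun.mem_St (h : IsRun f reg P X Z B τ) (k : ℕ) : X k ∈ St n p := by
  induction k with
  | zero => exact h.init_mem
  | succ k ih =>
    rcases le_or_gt P.η₁ (ratio f reg (B k) (τ k) (X k) (Z k)) with hk | hk
    · rw [h.accept k hk]
      exact h.trial_mem k
    · rw [h.reject k hk]
      exact ih

theorem IsRun.tau_pos (h : IsRun f reg P X Z B τ) (k : ℕ) : 0 < τ k := by
  induction k with
  | zero => exact h.τ_pos
  | succ k ih =>
    rcases le_or_gt P.η₁ (ratio f reg (B k) (τ k) (X k) (Z k)) with hk | hk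
    · rcases le_or_gt P.η₂ (ratio f reg (B k) (τ k) (X k) (Z k)) with hk' | hk'
      · exact (h.τ_very_successful k hk').1
      · exact ih.trans_le (h.τ_successful k hk hk').1
    · exact (mul_pos (one_pos.trans P.one_lt_γ₁) ih).trans_le (h.τ_unsuccessful k hk).1

/-- The Dennis–Moré condition with the Hessian at the limit point. -/
theorem DennisMore.eventually_le (hDM : DennisMore f X Z B) (hH : HessContinuous f)
    (hXs : Xs ∈ St n p) (hX : ∀ k, X k ∈ St n p) (hlim : Tendsto X atTop (𝓝 Xs)) {ε : ℝ}
    (hε : 0 < ε) : ∀ᶠ k in atTop, ‖(B k - hess f Xs) (Z k - X k)‖ ≤ ε * ‖Z k - X k‖ := by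
  have h1 := (tendsto_iff_norm_sub_tendsto_zero.1 (hess_tendsto hH hXs hX hlim)).eventually_lt_const
    (half_pos hε)
  have h2 := (show Tendsto _ _ _ from hDM).eventually_lt_const (half_pos hε)
  filter_upwards [h1, h2] with k hk1 hk2
  have h3 : ‖(B k - hess f (X k)) (Z k - X k)‖ ≤ ε / 2 * ‖Z k - X k‖ := by
    rcases (norm_nonneg (Z k - X k)).eq_or_lt with h0 | h0
    · rw [eq_comm, norm_eq_zero] at h0
      simp [h0]
    · exact ((div_lt_iff₀ h0).1 hk2).le
  have h4 : ‖(hess f (X k) - hess f Xs) (Z k - X k)‖ ≤ ε / 2 * ‖Z k - X k‖ :=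
    (ContinuousLinearMap.le_opNorm _ _).trans (by gcongr)
  have h5 : (B k - hess f Xs) (Z k - X k)
      = (B k - hess f (X k)) (Z k - X k) + (hess f (X k) - hess f Xs) (Z k - X k) := by
    simp only [sub_apply]
    abel
  rw [h5]
  refine (norm_add_le _ _).trans ?_
  linarith

/-- Once all iterations are very successful the regularization parameter decays geometrically. -/
theorem IsRun.tendsto_tau (h : IsRun f reg P X Z B τ)
    (hvs : ∀ᶠ k in atTop, P.η₂ ≤ ratio f reg (B k) (τ k) (X k) (Z k)) :
    Tendsto τ atTop (𝓝 0) := by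
  obtain ⟨N, hN⟩ := eventually_atTop.1 hvs
  rw [← tendsto_add_atTop_iff_nat N]
  have hb : ∀ j, τ (j + N) ≤ P.γ₀ ^ j * τ N := by
    intro j
    induction j with
    | zero => simp
    | succ j ih =>
      rw [add_right_comm, pow_succ', mul_assoc]
      exact (h.τ_very_successful _ (hN _ (Nat.le_add_left N j))).2.trans
        (mul_le_mul_of_nonneg_left ih P.γ₀_pos.le)
  refine squeeze_zero (fun j => (h.tau_pos _).le) hb ?_
  simpa using (tendsto_pow_atTop_nhds_zero_of_lt_one P.γ₀_pos.le P.γ₀_lt_one).mul_const (τ N)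

/-- Superlinear decay of the Riemannian gradients gives superlinear convergence in geodesic
distance, because gradient norm, Frobenius distance and geodesic distance are locally equivalent. -/
theorem qSuperlinear_of_rgrad (hf : Differentiable ℝ f) (hH : HessContinuous f)
    (hXs : Xs ∈ St n p) (hstat : rgrad f Xs = 0) (hpos : RHessPosDef f Xs)
    (hX : ∀ k, X k ∈ St n p) (hne : ∀ k, rgrad f (X k) ≠ 0) (hlim : Tendsto X atTop (𝓝 Xs))
    (hsup : ∀ ε > 0, ∀ᶠ k in atTop, ‖rgrad f (X (k + 1))‖ ≤ ε * ‖rgrad f (X k)‖) :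
    QSuperlinear X Xs := by
  obtain ⟨C, hC, r, hr, hbd⟩ := exists_error_bound hf hH hXs hstat hpos
  have hdist := tendsto_iff_norm_sub_tendsto_zero.1 hlim
  set c : ℝ := p * (p + 4) with hc
  have hc0 : 0 ≤ c := by positivity
  have hnear : ∀ᶠ k in atTop, ‖X k - Xs‖ ≤ geodDist (X k) Xs ∧
      geodDist (X k) Xs ≤ c * ‖X k - Xs‖ := by
    filter_upwards [hdist.eventually_lt_const one_pos] with k hk
    have h1 := norm_sub_le_geodDist_le (hX k) hXs (by rw [norm_sub_rev]; exact hk.le)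
    rw [norm_sub_rev Xs] at h1
    refine ⟨h1.1, h1.2.trans ?_⟩
    have h2 : ‖X k‖ ≤ p + 1 := by
      nlinarith [norm_of_mem_St (hX k), sq_nonneg (‖X k‖ - 1)]
    rw [hc]
    gcongr ?_ * ?_ * ?_
    linarith
  have hposd : ∀ k, 0 < ‖X k - Xs‖ := by
    intro k
    rw [norm_pos_iff, sub_ne_zero]
    rintro h
    exact hne k (h ▸ hstat)
  have hposg : ∀ᶠ k in atTop, 0 < geodDist (X k) Xs :=
    hnear.mono fun k hk => (hposd k).trans_le hk.1
  refine ⟨?_, hposg, ?_⟩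
  · refine squeeze_zero' (hposg.mono fun k hk => hk.le) (hnear.mono fun k hk => hk.2) ?_
    simpa using hdist.const_mul c
  · refine Metric.tendsto_nhds.2 fun ε hε => ?_
    set ε' := ε / (2 * (c + 1) * C * C) with hε'
    have hε'0 : 0 < ε' := by positivity
    have hεε : (c + 1) * C * ε' * C = ε / 2 := by
      rw [hε']
      field_simp
    filter_upwards [hnear, (tendsto_add_atTop_nat 1).eventually hnear, hposg,
      (tendsto_add_atTop_nat 1).eventually hposg, hsup ε' hε'0,
      hdist.eventually_lt_const hr,
      (tendsto_add_atTop_nat 1).eventually (hdist.eventually_lt_const hr)]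
      with k h1 h2 h3 h4 h5 h6 h7
    rw [Real.dist_eq, sub_zero, abs_of_pos (div_pos h4 h3), div_lt_iff₀ h3]
    have h8 := (hbd _ (hX k) h6).2.1
    have h9 := (hbd _ (hX (k + 1)) h7).2.2
    calc geodDist (X (k + 1)) Xs ≤ c * ‖X (k + 1) - Xs‖ := h2.2
      _ ≤ (c + 1) * (C * (ε' * (C * ‖X k - Xs‖))) := by
        gcongr
        · linarith
        · exact h9.trans (by gcongr; exact h5.trans (by gcongr))
      _ = (c + 1) * C * ε' * C * ‖X k - Xs‖ := by ring
      _ = ε / 2 * ‖X k - Xs‖ := by rw [hεε]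
      _ ≤ ε / 2 * geodDist (X k) Xs := by
        gcongr
        exact h1.1
      _ < ε * geodDist (X k) Xs := by
        gcongr
        linarith

end Run

end StiefelQN

theorem mainTheorem2 (n p : ℕ) (f : StiefelQN.Mat n p → ℝ) (hf : Differentiable ℝ f)
    (hB2 : StiefelQN.HessContinuous f)
    (Xs : StiefelQN.Mat n p) (hXs : Xs ∈ StiefelQN.St n p)
    (hstat : StiefelQN.rgrad f Xs = 0) (hB3 : StiefelQN.RHessPosDef f Xs) :
    ∃ δ : ℝ, 0 < δ ∧
      ∀ (reg : StiefelQN.Regularization) (P : StiefelQN.Params)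
        (X Z : ℕ → StiefelQN.Mat n p) (B : ℕ → StiefelQN.Mat n p →L[ℝ] StiefelQN.Mat n p)
        (τ : ℕ → ℝ) (c : ℝ),
        StiefelQN.IsRun f reg P X Z B τ →
        Tendsto X atTop (𝓝 Xs) →
        (∀ᶠ k in atTop, ‖Z k - X k‖ < δ) →
        StiefelQN.DennisMore f X Z B →
        0 < c →
        StiefelQN.Inexact₁ f reg X Z B τ c →
        StiefelQN.Inexact₂ f reg X Z B τ →
        (∀ᶠ k in atTop, P.η₂ ≤ StiefelQN.ratio f reg (B k) (τ k) (X k) (Z k)) ∧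
          StiefelQN.QSuperlinear X Xs := by
  open StiefelQN in
  obtain ⟨μ, hμ, r, hr, hco⟩ := exists_chord_coercive hXs hB3
  obtain ⟨C, hC, r', hr', hbd⟩ := exists_error_bound hf hB2 hXs hstat hB3
  -- `δ = r / 2` puts both ends of the chord from `X k` to `Z k` into the ball of radius `r` on
  -- which the Hessian of the Lagrangian is coercive along chords.
  refine ⟨r / 2, half_pos hr, ?_⟩
  intro reg P X Z B τ c hrun hlim hshort hDM hc hI1 hI2
  have hX := hrun.mem_St
  have hZ := hrun.trial_mem
  have hdist := tendsto_iff_norm_sub_tendsto_zero.1 hlim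
  have hg0 : ∀ k, 0 < ‖rgrad f (X k)‖ := fun k => norm_pos_iff.2 (hrun.not_stopped k)
  have hneg : ∀ k, model f reg (B k) (τ k) (X k) (Z k) < 0 := fun k =>
    (hI1 k).trans_lt (by nlinarith [mul_pos hc (pow_pos (hg0 k) 2)])
  have hstep : ∀ᶠ k in atTop, ‖Z k - X k‖ ≤ 4 / μ * ‖lagrGrad f Xs (X k)‖ := by
    filter_upwards [hshort, hdist.eventually_lt_const (half_pos hr),
      hDM.eventually_le hB2 hXs hX hlim (half_pos hμ)] with k h1 h2 h3
    have h4 : ‖Z k - Xs‖ < r := by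
      have := norm_add_le (Z k - X k) (X k - Xs)
      rw [sub_add_sub_cancel] at this
      linarith
    have h5 := norm_step_le (hrun.tau_pos k).le (hX k) (hZ k)
      (hco _ (hX k) _ (hZ k) (by linarith) h4) h3 (hneg k).le
    rw [div_mul_eq_mul_div, le_div_iff₀ hμ]
    linarith
  have hstepX : ∀ᶠ k in atTop, ‖Z k - X k‖ ≤ 4 / μ * C * ‖X k - Xs‖ := by
    filter_upwards [hstep, hdist.eventually_lt_const hr'] with k h1 h2
    rw [mul_assoc]
    exact h1.trans (by gcongr; exact (hbd _ (hX k) h2).1)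
  set K := 4 / μ * C * C with hK
  have hK0 : 0 < K := by positivity
  have hstepg : ∀ᶠ k in atTop, ‖Z k - X k‖ ≤ K * ‖rgrad f (X k)‖ := by
    filter_upwards [hstepX, hdist.eventually_lt_const hr'] with k h1 h2
    rw [hK, mul_assoc]
    exact h1.trans (by gcongr; exact (hbd _ (hX k) h2).2.2)
  have hs0 : Tendsto (fun k => ‖Z k - X k‖) atTop (𝓝 0) := by
    refine squeeze_zero' (Eventually.of_forall fun k => norm_nonneg _) hstepX ?_
    simpa using hdist.const_mul (4 / μ * C)
  have hZdist : Tendsto (fun k => ‖Z k - Xs‖) atTop (𝓝 0) := by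
    refine squeeze_zero (fun k => norm_nonneg _) (fun k => ?_) (by simpa using hs0.add hdist)
    simpa using norm_add_le (Z k - X k) (X k - Xs)
  have hg : Tendsto (fun k => ‖rgrad f (X k)‖) atTop (𝓝 0) := by
    refine squeeze_zero' (Eventually.of_forall fun k => norm_nonneg _) ?_
      (by simpa using hdist.const_mul C)
    filter_upwards [hdist.eventually_lt_const hr'] with k h2
    exact (hbd _ (hX k) h2).2.1
  have hvs : ∀ᶠ k in atTop, P.η₂ ≤ ratio f reg (B k) (τ k) (X k) (Z k) := by
    have hη : 0 < 1 - P.η₂ := by linarith [P.η₂_lt_one]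
    set ε := (1 - P.η₂) * c / (2 * K ^ 2) with hε
    have hε0 : 0 < ε := by positivity
    obtain ⟨ρ, hρ, hex⟩ := exists_expansion hf hB2 hXs hε0
    filter_upwards [hstepg, hdist.eventually_lt_const hρ, hZdist.eventually_lt_const hρ,
      hDM.eventually_le hB2 hXs hX hlim hε0] with k h1 h2 h3 h4
    have h5 := sub_le_model_add (reg := reg) (hrun.tau_pos k).le
      (hex _ (hX k) _ (hZ k) h2 h3).2 h4
    have h6 : 2 * ε * ‖Z k - X k‖ ^ 2 ≤ (1 - P.η₂) * (c * ‖rgrad f (X k)‖ ^ 2) := by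
      calc 2 * ε * ‖Z k - X k‖ ^ 2 ≤ 2 * ε * (K * ‖rgrad f (X k)‖) ^ 2 := by gcongr
        _ = _ := by
          rw [hε]
          field_simp
    have h7 := hI1 k
    rw [ratio, le_div_iff_of_neg (hneg k)]
    nlinarith
  refine ⟨hvs, qSuperlinear_of_rgrad hf hB2 hXs hstat hB3 hX hrun.not_stopped hlim ?_⟩
  intro ε hε
  -- `1 + p` bounds the norm of the tangent projections, `K` the ratio of step to gradient.
  set b := (1 + (p : ℝ)) * K with hb
  have hb0 : 0 < b := by positivity
  -- The three error sources (inexact solution, Dennis–Moré together with the expansion,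
  -- regularization) get the shares `ε / 4`, `ε / 2` and `ε / 4`.
  have hε1 : 0 < ε / (4 * b) := by positivity
  obtain ⟨ρ, hρ, hex⟩ := exists_expansion hf hB2 hXs hε1
  filter_upwards [hstepg, hdist.eventually_lt_const hρ, hZdist.eventually_lt_const hρ,
    hDM.eventually_le hB2 hXs hX hlim hε1, hvs, (hrun.tendsto_tau hvs).eventually_lt_const hε1,
    hs0.eventually_lt_const one_pos, hg.eventually_lt_const (show 0 < ε / 4 by positivity)]
    with k h1 h2 h3 h4 h5 h6 h7 h8
  rw [hrun.accept k (P.η₁_le_η₂.trans h5)]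
  have h9 := norm_rgrad_trial_le (reg := reg) (hrun.symm k) (hrun.tau_pos k).le (hZ k)
    (hex _ (hX k) _ (hZ k) h2 h3).1 h4 h7.le
  have h10 : ‖rgrad (model f reg (B k) (τ k) (X k)) (Z k)‖ ≤ ε / 4 * ‖rgrad f (X k)‖ :=
    (hI2 k).trans (by
      gcongr
      exact (min_le_right _ _).trans h8.le)
  have h11 : (1 + (p : ℝ)) * (2 * (ε / (4 * b)) + τ k) * ‖Z k - X k‖
      ≤ 3 * ε / 4 * ‖rgrad f (X k)‖ := by
    calc _ ≤ (1 + (p : ℝ)) * (2 * (ε / (4 * b)) + ε / (4 * b)) * (K * ‖rgrad f (X k)‖) := by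
          gcongr
      _ = 3 * (b * (ε / (4 * b))) * ‖rgrad f (X k)‖ := by
          rw [hb]
          ring
      _ = _ := by
          field_simp
  linarith
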